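/- **Conventions.** Let $G$ be a group, let $\mathcal P$ be a $G$-poset (a poset with an action of $G$ by order-preserving maps, written ${}^gx$), and let $k$ be a commutative ring (for instance a field). The *transporter category* $\mathcal P\rtimes G$ has the elements of $\mathcal P$ as objects, and its morphisms $x\to y$ are the pairs $\alpha g$ with $g\in G$ and $\alpha:{}^gx\to y$ in $\mathcal P$ (i.e. ${}^gx\le y$); composition is $(\alpha g)(\beta h)=(\alpha\,{}^g\beta)(gh)$. A *transporter subcategory* $\mathcal Q\rtimes H$ is given by a subgroup $H\le G$ and an $H$-stable subposet $\mathcal Q\subseteq\mathcal P$ with the induced order. Its conjugate is ${}^g(\mathcal Q\rtimes H)={}^g\mathcal Q\rtimes{}^gH$ with ${}^gH=gHg^{-1}$; put $H^g=g^{-1}Hg$ and $\mathcal Q^g={}^{g^{-1}}\mathcal Q$. For a small category $\mathcal C$, a $k\mathcal C$-module is a functor from $\mathcal C$ to $k$-modules. For a subcategory $\mathcal D\subseteq\mathcal C$, $\downarrow^{\mathcal C}_{\mathcal D}$ denotes restriction and $\uparrow^{\mathcal C}_{\mathcal D}$ the left Kan extension along the inclusion $\iota$, so that $(N\uparrow^{\mathcal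 C}_{\mathcal D})(x)=\varinjlim_{\iota/x}N$. If $N$ is a $k\mathcal Q\rtimes H$-module, ${}^gN$ is the $k\,{}^g(\mathcal Q\rtimes H)$-module with ${}^gN({}^gx)=N(x)$ on which ${}^g\alpha\,{}^gh$ acts as $\alpha h$ does on $N$. The support $\operatorname{supp}M$ of a $k\mathcal C$-module $M$ is the full subcategory on the objects $x$ with $M(x)\neq0$, and its convex support $\operatorname{supp}^cM$ is the full subcategory on the objects $y$ that admit morphisms $x\to y\to z$ with $x,z\in\operatorname{supp}M$. For a $k\mathcal Q\rtimes H$-module $N$ write $\operatorname{supp}N=\mathcal Q_N\rtimes H$ and $\operatorname{supp}^cN=\mathcal Q_N^c\rtimes H$. For $A\subseteq\mathcal P$ let $\underbrace{A}$ be the smallest coideal (up-closed subset) of $\mathcal P$ that contains $A$, and $\underbrace{{}_GA}$ the smallest $G$-stable one. For $U\subseteq\mathcal P$ and $x\in\mathcal P$ put $U_{\le x}=\{y\in U: y\le x\}$. An ideal of a poset is a down-closed subset. **Theorem (Mackey formula for transporter categories).** Let $\mathcal Q\rtimes H$ and $\mathcal R\rtimes K$ be transporter subcategories of $\mathcal P\rtimes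 G$, and let $N$ be a $k\mathcal Q\rtimes H$-module. Consider the condition $$(\ast)\qquad \bigl({}^g(\underbrace{\mathcal Q_N})\bigr)_{\le x}\subseteq\mathcal R_{\le x}\quad\text{for all } g\in G \text{ and } x\in\mathcal R .$$ 1. If $\mathcal R$ is an ideal of $\mathcal P$, then $(\ast)$ holds. 2. Suppose that $(\ast)$ holds. Then $\mathcal R\cap\underbrace{{}_G(\mathcal Q_N^c)}$ is an ideal in $\underbrace{{}_G(\mathcal Q_N^c)}$, and the objects of $\operatorname{supp}^c(N\uparrow^{\mathcal P\rtimes G}_{\mathcal Q\rtimes H})$ lie in $\underbrace{{}_G(\mathcal Q_N^c)}$. Moreover, for every set $[K\backslash G/H]$ of representatives of the double cosets $KgH$ in $G$, there is an isomorphism of $k\mathcal R\rtimes K$-modules $$N\uparrow^{\mathcal P\rtimes G}_{\mathcal Q\rtimes H}\downarrow^{\mathcal P\rtimes G}_{\mathcal R\rtimes K}\;\cong\bigoplus_{g\in[K\backslash G/H]}\bigl[{}^g\bigl(N\downarrow^{\mathcal Q\rtimes H}_{(\mathcal R^g\cap\mathcal Q)\rtimes(K^g\cap H)}\bigr)\bigr]\uparrow^{\mathcal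 R\rtimes K}_{(\mathcal R\cap{}^g\mathcal Q)\rtimes(K\cap{}^gH)},$$ where $(\mathcal R\cap{}^g\mathcal Q)\rtimes(K\cap{}^gH)={}^g\bigl((\mathcal R^g\cap\mathcal Q)\rtimes(K^g\cap H)\bigr)$. -/

import Mathlib

open CategoryTheory CategoryTheory.Limits
open scoped Pointwise

universe u v w t

/-- The objects of the transporter category `P ⋊ G` of a group `G` on a `G`-poset `P`: they are
the elements of `P`.  (A wrapper, so that the category structure is not confused with the one
of the poset `P` itself.) -/
@[ext]
structure Transporter (G : Type u) (P : Type v) : Type v where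
  /-- the underlying element of the poset -/
  pt : P

namespace Transporter

/-- A morphism `α g : x ⟶ y` of `P ⋊ G`: an element `g` of `G` with a (necessarily unique)
morphism `α : g • x ⟶ y` of the poset `P`, i.e. the relation `g • x ≤ y`. -/
@[ext]
structure Hom {G : Type u} {P : Type v} [LE P] [SMul G P] (x y : Transporter G P) : Type u where
  /-- the group element -/
  elt : G
  /-- the morphism of the poset -/
  rel : elt • x.pt ≤ y.pt

/-- The transporter category `P ⋊ G`; the composite of `β h : x ⟶ y` and `α g : y ⟶ z` is
`(α (g • β)) (g * h) : x ⟶ z`. -/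
instance category {G : Type u} [Group G] {P : Type v} [PartialOrder P] [MulAction G P]
    [CovariantClass G P (· • ·) (· ≤ ·)] : Category.{u} (Transporter G P) where
  Hom x y := Hom x y
  id x := ⟨1, by simp⟩
  comp {x y z} b a := ⟨a.elt * b.elt, by
    rw [mul_smul]
    exact (smul_mono_right a.elt b.rel).trans a.rel⟩
  id_comp _ := Hom.ext (mul_one _)
  comp_id _ := Hom.ext (one_mul _)
  assoc _ _ _ := Hom.ext (mul_assoc _ _ _).symm

/-- The functor `P' ⋊ G' ⥤ P ⋊ G` given by a group homomorphism `φ : G' → G` and a `φ`-equivariant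
order-preserving map `f : P' → P`: it sends `x` to `f x` and `α g` to `f α (φ g)`. -/
def map {G' : Type u} [Group G'] {P' : Type v} [PartialOrder P'] [MulAction G' P']
    [CovariantClass G' P' (· • ·) (· ≤ ·)]
    {G : Type u} [Group G] {P : Type v} [PartialOrder P] [MulAction G P]
    [CovariantClass G P (· • ·) (· ≤ ·)]
    (φ : G' →* G) (f : P' →o P) (hf : ∀ (g : G') (x : P'), f (g • x) = φ g • f x) :
    Transporter G' P' ⥤ Transporter G P where
  obj x := ⟨f x.pt⟩
  map {x y} a := ⟨φ a.elt, by
    rw [← hf]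
    exact f.monotone a.rel⟩
  map_id _ := Hom.ext (map_one φ)
  map_comp _ _ := Hom.ext (map_mul φ _ _)

end Transporter

/-- A transporter subcategory `Q ⋊ H` of `P ⋊ G`, given by a subgroup `H` of `G` and an
`H`-stable subset `Q` of `P` (with the induced order). -/
@[ext]
structure TransporterSub (G : Type u) [Group G] (P : Type v) [MulAction G P] where
  /-- the subgroup `H` -/
  grp : Subgroup G
  /-- the underlying set of the subposet `Q` -/
  carrier : Set P
  smul_mem : ∀ h ∈ grp, ∀ x ∈ carrier, h • x ∈ carrier

namespace TransporterSub

section Basic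

variable {G : Type u} [Group G] {P : Type v} [MulAction G P]

/-- `Q` is an `H`-poset. -/
instance mulAction (S : TransporterSub G P) : MulAction S.grp S.carrier where
  smul h x := ⟨(h : G) • (x : P), S.smul_mem h h.2 x x.2⟩
  one_smul x := Subtype.ext (one_smul G (x : P))
  mul_smul a b x := Subtype.ext (mul_smul (a : G) (b : G) (x : P))

instance covariant [PartialOrder P] [CovariantClass G P (· • ·) (· ≤ ·)]
    (S : TransporterSub G P) : CovariantClass S.grp S.carrier (· • ·) (· ≤ ·) where
  elim h _ _ hxy := smul_mono_right (h : G) (show (_ : P) ≤ _ from hxy)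

/-- Inclusion of transporter subcategories. -/
instance : LE (TransporterSub G P) where
  le S T := S.grp ≤ T.grp ∧ S.carrier ⊆ T.carrier

/-- The intersection `(Q ∩ R) ⋊ (H ∩ K)` of `Q ⋊ H` and `R ⋊ K`. -/
instance : Min (TransporterSub G P) where
  min S T :=
    { grp := S.grp ⊓ T.grp
      carrier := S.carrier ∩ T.carrier
      smul_mem := fun h hh x hx =>
        ⟨S.smul_mem h hh.1 x hx.1, T.smul_mem h hh.2 x hx.2⟩ }

theorem inf_le_left' (S T : TransporterSub G P) : S ⊓ T ≤ S :=
  ⟨fun _ h => h.1, fun _ h => h.1⟩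

theorem inf_le_right' (S T : TransporterSub G P) : S ⊓ T ≤ T :=
  ⟨fun _ h => h.2, fun _ h => h.2⟩

theorem le_of_eq' {S T : TransporterSub G P} (h : S = T) : S ≤ T :=
  h ▸ ⟨le_rfl, subset_rfl⟩

/-- The conjugate `ᵍ(Q ⋊ H) = ᵍQ ⋊ ᵍH`, where `ᵍQ = {g • x | x ∈ Q}` and `ᵍH = g H g⁻¹`. -/
def conj (g : G) (S : TransporterSub G P) : TransporterSub G P where
  grp := S.grp.map (MulAut.conj g).toMonoidHom
  carrier := g • S.carrier
  smul_mem := by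
    rintro _ ⟨h, hh, rfl⟩ _ ⟨x, hx, rfl⟩
    refine ⟨h • x, S.smul_mem h hh x hx, ?_⟩
    simp [mul_smul]

theorem inv_mul_mul_mem {g a : G} {S : TransporterSub G P} (h : a ∈ (S.conj g).grp) :
    g⁻¹ * a * g ∈ S.grp := by
  obtain ⟨b, hb, rfl⟩ := h
  simpa [mul_assoc] using hb

theorem inv_smul_mem {g : G} {x : P} {S : TransporterSub G P} (h : x ∈ (S.conj g).carrier) :
    g⁻¹ • x ∈ S.carrier :=
  Set.mem_smul_set_iff_inv_smul_mem.1 h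

/-- `ᵍ((Rᵍ ∩ Q) ⋊ (Kᵍ ∩ H)) = (R ∩ ᵍQ) ⋊ (K ∩ ᵍH)`, where `Rᵍ = g⁻¹ • R` and
`Kᵍ = g⁻¹ K g`. -/
theorem conj_inf_conj_inv (g : G) (S T : TransporterSub G P) :
    (T.conj g⁻¹ ⊓ S).conj g = T ⊓ S.conj g := by
  ext a
  · constructor
    · rintro ⟨b, ⟨⟨c, hc, rfl⟩, hb⟩, rfl⟩
      refine ⟨?_, ⟨_, hb, rfl⟩⟩
      simpa [mul_assoc] using hc
    · rintro ⟨ha, b, hb, rfl⟩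
      exact ⟨b, ⟨⟨_, ha, by simp [mul_assoc]⟩, hb⟩, rfl⟩
  · constructor
    · rintro ⟨b, ⟨⟨c, hc, rfl⟩, hb⟩, rfl⟩
      refine ⟨?_, ⟨_, hb, rfl⟩⟩
      simpa using hc
    · rintro ⟨ha, b, hb, rfl⟩
      exact ⟨b, ⟨⟨_, ha, by simp⟩, hb⟩, rfl⟩

end Basic

variable {G : Type u} [Group G] {P : Type v} [PartialOrder P] [MulAction G P]
  [CovariantClass G P (· • ·) (· ≤ ·)]

/-- The category `Q ⋊ H`, i.e. the transporter category of `H` on the `H`-poset `Q`. -/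
abbrev Cat (S : TransporterSub G P) : Type v := Transporter S.grp S.carrier

/-- The inclusion functor of `Q ⋊ H` in `P ⋊ G`. -/
def incl (S : TransporterSub G P) : S.Cat ⥤ Transporter G P :=
  Transporter.map S.grp.subtype ⟨Subtype.val, fun _ _ h => h⟩ fun _ _ => rfl

/-- The inclusion functor of a transporter subcategory in a larger one. -/
def inclOfLE {S T : TransporterSub G P} (h : S ≤ T) : S.Cat ⥤ T.Cat :=
  Transporter.map (Subgroup.inclusion h.1) ⟨Set.inclusion h.2, fun _ _ hxy => hxy⟩
    fun _ _ => rfl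

/-- The isomorphism of categories `ᵍ(Q ⋊ H) ⥤ Q ⋊ H` that sends `ᵍx` to `x` and the morphism
`ᵍα ᵍh` to `α h`. -/
def unconj (g : G) (S : TransporterSub G P) : (S.conj g).Cat ⥤ S.Cat :=
  Transporter.map
    { toFun := fun a => ⟨g⁻¹ * a * g, inv_mul_mul_mem a.2⟩
      map_one' := Subtype.ext (by simp)
      map_mul' := fun a b => Subtype.ext (by simp [mul_assoc]) }
    ⟨fun x => ⟨g⁻¹ • (x : P), inv_smul_mem x.2⟩, fun _ _ hxy =>
      smul_mono_right g⁻¹ (show (_ : P) ≤ _ from hxy)⟩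
    fun a x => Subtype.ext (by
      change g⁻¹ • (a : G) • (x : P) = (g⁻¹ * a * g) • g⁻¹ • (x : P)
      simp [mul_smul])

end TransporterSub

section Modules

/-- The restriction `Res_τ M` of a module (a functor to `k`-modules) along a functor `τ`. -/
abbrev resModule {k : Type w} [CommRing k] {D C : Type v} [Category.{u} D] [Category.{u} C]
    (τ : D ⥤ C) (M : C ⥤ ModuleCat.{max t u v} k) : D ⥤ ModuleCat.{max t u v} k :=
  τ ⋙ M

/-- The left Kan extension `LK_τ N` along `τ`: its value at `x` is the colimit of `N` over the
category of objects of `D` over `x`. -/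
noncomputable def indModule {k : Type w} [CommRing k] {D C : Type v} [Category.{u} D]
    [Category.{u} C] (τ : D ⥤ C) (N : D ⥤ ModuleCat.{max t u v} k) :
    C ⥤ ModuleCat.{max t u v} k :=
  τ.pointwiseLeftKanExtension N

/-- The objects of the support of a module `M`: those with `M(x) ≠ 0`. -/
def moduleSupport {k : Type w} [CommRing k] {C : Type v} [Category.{u} C]
    (M : C ⥤ ModuleCat.{t} k) : Set C :=
  {x | Nontrivial (M.obj x)}

/-- The objects of the convex support of `M`, the convex hull of its support: the objects `y` that
admit morphisms `x ⟶ y ⟶ z` with `M(x) ≠ 0` and `M(z) ≠ 0`. -/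
def moduleConvexSupport {k : Type w} [CommRing k] {C : Type v} [Category.{u} C]
    (M : C ⥤ ModuleCat.{t} k) : Set C :=
  {y | ∃ x ∈ moduleSupport M, ∃ z ∈ moduleSupport M, Nonempty (x ⟶ y) ∧ Nonempty (y ⟶ z)}

variable {G : Type u} [Group G] {P : Type v} [PartialOrder P] [MulAction G P]
  [CovariantClass G P (· • ·) (· ≤ ·)]

/-- The conjugate `ᵍN` of a `k(Q ⋊ H)`-module `N`, a module over `ᵍ(Q ⋊ H)`: one has
`ᵍN(ᵍx) = N(x)`, and `ᵍα ᵍh` acts on it as `α h` does on `N(x)`. -/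
abbrev conjModule {k : Type w} [CommRing k] (g : G) {S : TransporterSub G P}
    (N : S.Cat ⥤ ModuleCat.{max t u v} k) : (S.conj g).Cat ⥤ ModuleCat.{max t u v} k :=
  S.unconj g ⋙ N

/-- The subset `Q_N` of `P` with `supp N = Q_N ⋊ H`. -/
def supportPoset {k : Type w} [CommRing k] {S : TransporterSub G P}
    (N : S.Cat ⥤ ModuleCat.{t} k) : Set P :=
  (fun x : S.Cat => (x.pt : P)) '' moduleSupport N

/-- The subset `Q_Nᶜ` of `P` with `suppᶜ N = Q_Nᶜ ⋊ H`. -/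
def convexSupportPoset {k : Type w} [CommRing k] {S : TransporterSub G P}
    (N : S.Cat ⥤ ModuleCat.{t} k) : Set P :=
  (fun x : S.Cat => (x.pt : P)) '' moduleConvexSupport N

end Modules

section Coideals

variable {G : Type u} [Group G] {P : Type v} [PartialOrder P] [MulAction G P]

/-- The `H`-coideal of `P` generated by `A`: the elements `y` with `h • x ≤ y` for some
`h ∈ H` and `x ∈ A`. -/
def coidealGen (H : Subgroup G) (A : Set P) : Set P :=
  {y | ∃ h ∈ H, ∃ x ∈ A, h • x ≤ y}

/-- `coidealGen H A` is the smallest coideal of `P` that is stable under `H` and contains `A`. -/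
theorem coidealGen_isLeast [CovariantClass G P (· • ·) (· ≤ ·)] (H : Subgroup G) (A : Set P) :
    IsLeast {B : Set P | A ⊆ B ∧ IsUpperSet B ∧ ∀ h ∈ H, ∀ x ∈ B, h • x ∈ B}
      (coidealGen H A) := by
  refine ⟨⟨fun x hx => ⟨1, H.one_mem, x, hx, by simp⟩, ?_, ?_⟩, ?_⟩
  · rintro a b hab ⟨h, hh, x, hx, hxa⟩
    exact ⟨h, hh, x, hx, hxa.trans hab⟩
  · rintro h hh y ⟨h', hh', x, hx, hxy⟩
    exact ⟨h * h', H.mul_mem hh hh', x, hx, by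
      rw [mul_smul]
      exact smul_mono_right h hxy⟩
  · rintro B ⟨hAB, hup, hst⟩ y ⟨h, hh, x, hx, hxy⟩
    exact hup hxy (hst h hh x (hAB hx))

/-- `A` is an ideal in the subposet `B` of `P`. -/
def IsIdealIn (A B : Set P) : Prop :=
  A ⊆ B ∧ ∀ x ∈ A, ∀ y ∈ B, y ≤ x → y ∈ A

/-- The condition that, for all `g ∈ G` and `x ∈ R`, the elements below `x` of the conjugate `ᵍU`
of the coideal `U` of `P` generated by `Q_N` belong to `R`. -/
def MackeyCondition [CovariantClass G P (· • ·) (· ≤ ·)] {k : Type w} [CommRing k]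
    (S T : TransporterSub G P) (N : S.Cat ⥤ ModuleCat.{t} k) : Prop :=
  ∀ (g : G), ∀ x ∈ T.carrier,
    (g • coidealGen (⊥ : Subgroup G) (supportPoset N)) ∩ Set.Iic x ⊆ T.carrier ∩ Set.Iic x

/-- `D` is a set `[K \ G / H]` of representatives of the double cosets `K g H`. -/
def IsDoubleCosetReps (K H : Subgroup G) (D : Set G) : Prop :=
  ∀ a : G, ∃! g, g ∈ D ∧ a ∈ DoubleCoset.doubleCoset g (K : Set G) (H : Set G)

end Coideals

/-- The summand `[ᵍ(N ↓_{(Rᵍ ∩ Q) ⋊ (Kᵍ ∩ H)})] ↑^{R ⋊ K}` at `g`, the induction being from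
`(R ∩ ᵍQ) ⋊ (K ∩ ᵍH) = ᵍ((Rᵍ ∩ Q) ⋊ (Kᵍ ∩ H))`. -/
noncomputable def mackeySummand {G : Type u} [Group G] {P : Type v} [PartialOrder P]
    [MulAction G P] [CovariantClass G P (· • ·) (· ≤ ·)] {k : Type w} [CommRing k]
    (S T : TransporterSub G P) (N : S.Cat ⥤ ModuleCat.{max t u v} k) (g : G) :
    T.Cat ⥤ ModuleCat.{max t u v} k :=
  indModule.{u, v, w, t} (TransporterSub.inclOfLE (TransporterSub.inf_le_left' T (S.conj g)))
    (resModule.{u, v, w, t}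
      (TransporterSub.inclOfLE
        (TransporterSub.le_of_eq' (TransporterSub.conj_inf_conj_inv g S T).symm))
      (conjModule.{u, v, w, t} g
        (resModule.{u, v, w, t}
          (TransporterSub.inclOfLE (TransporterSub.inf_le_right' (T.conj g⁻¹) S)) N)))

/-! At an object `x` of `R ⋊ K`, the restricted induced module is the colimit of `N` over the pairs
`(q, a)` with `q` in `Q` and `a : q ⟶ x` in `P ⋊ G`. Pairs with `N q = 0` contribute nothing. If `q`
lies in the coideal generated by the support, `(∗)` puts `a • q`, which is below `x`, in `R`.
Writing the group element of `a` as `k g h` with `g` a representative, `y = g h • q = k⁻¹ a • q` is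
in `R ∩ ᵍQ`, and `a` factors as `q ≅ g⁻¹ • y ⟶ y ⟶ x` (`exists_mackeyFactor`): an index of the
summand at `g`.

Two factorizations of one `a` use the same `g` and differ by a morphism of `(R ∩ ᵍQ) ⋊ (K ∩ ᵍH)`, so
they define the same map to the summand (`MackeyFactor.map_toSummand`). Hence maps out of all
summands are the same as cocones on `N`, extended by zero off the support. This is the universal
property of the coproduct at `x`, and coproducts of functors are computed objectwise. -/

section Induction

/-! ### Left Kan extension as a pointwise colimit -/

variable {k : Type w} [CommRing k] {D C : Type v} [Category.{u} D] [Category.{u} C]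
  (τ : D ⥤ C) (N : D ⥤ ModuleCat.{max t u v} k)

/-- The canonical map from `N d` to the colimit `(indModule τ N) x` at an object `τ d ⟶ x` over
`x`. -/
noncomputable def indInj {d : D} {x : C} (f : τ.obj d ⟶ x) :
    N.obj d ⟶ (indModule.{u, v, w, t} τ N).obj x :=
  (τ.pointwiseLeftKanExtensionUnit N).app d ≫ (τ.pointwiseLeftKanExtension N).map f

theorem indInj_map {d : D} {x y : C} (f : τ.obj d ⟶ x) (φ : x ⟶ y) :
    indInj.{u, v, w, t} τ N f ≫ (indModule.{u, v, w, t} τ N).map φ =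
      indInj.{u, v, w, t} τ N (f ≫ φ) := by
  exact (Category.assoc _ _ _).trans
    (congrArg _ ((τ.pointwiseLeftKanExtension N).map_comp f φ).symm)

theorem map_indInj {d d' : D} {x : C} (φ : d ⟶ d') (f : τ.obj d' ⟶ x) :
    N.map φ ≫ indInj.{u, v, w, t} τ N f = indInj.{u, v, w, t} τ N (τ.map φ ≫ f) := by
  have h := (τ.pointwiseLeftKanExtensionUnit N).naturality φ
  exact (Category.assoc _ _ _).symm.trans ((congrArg (· ≫ _) h).trans ((Category.assoc _ _ _).trans
    (congrArg _ ((τ.pointwiseLeftKanExtension N).map_comp (τ.map φ) f).symm)))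

variable {τ N}

theorem indModule_hom_ext {x : C} {A : ModuleCat.{max t u v} k}
    {p q : (indModule.{u, v, w, t} τ N).obj x ⟶ A}
    (h : ∀ (d : D) (f : τ.obj d ⟶ x),
      indInj.{u, v, w, t} τ N f ≫ p = indInj.{u, v, w, t} τ N f ≫ q) : p = q :=
  (τ.pointwiseLeftKanExtensionIsPointwiseLeftKanExtension N x).hom_ext fun j => h j.left j.hom

/-- The map out of `(indModule τ N) x` given by a compatible family of maps. -/
noncomputable def indDesc {x : C} {A : ModuleCat.{max t u v} k}
    (c : ∀ (d : D), (τ.obj d ⟶ x) → (N.obj d ⟶ A))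
    (hc : ∀ {d d' : D} (φ : d ⟶ d') (f : τ.obj d' ⟶ x), N.map φ ≫ c d' f = c d (τ.map φ ≫ f)) :
    (indModule.{u, v, w, t} τ N).obj x ⟶ A :=
  (τ.pointwiseLeftKanExtensionIsPointwiseLeftKanExtension N x).desc
    { pt := A
      ι :=
        { app := fun j => c j.left j.hom
          naturality := fun i j φ => by
            have := hc φ.left j.hom
            rw [CostructuredArrow.w φ] at this
            exact this.trans (Category.comp_id _).symm } }

theorem indInj_desc {x : C} {A : ModuleCat.{max t u v} k}
    (c : ∀ (d : D), (τ.obj d ⟶ x) → (N.obj d ⟶ A))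
    (hc : ∀ {d d' : D} (φ : d ⟶ d') (f : τ.obj d' ⟶ x), N.map φ ≫ c d' f = c d (τ.map φ ≫ f))
    {d : D} (f : τ.obj d ⟶ x) :
    indInj.{u, v, w, t} τ N f ≫ indDesc.{u, v, w, t} c hc = c d f :=
  (τ.pointwiseLeftKanExtensionIsPointwiseLeftKanExtension N x).fac _ (CostructuredArrow.mk f)

/-- The morphism `indModule τ N ⟶ M` that corresponds to `α : N ⟶ τ ⋙ M`. -/
noncomputable def indHom {M : C ⥤ ModuleCat.{max t u v} k} (α : N ⟶ τ ⋙ M) :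
    indModule.{u, v, w, t} τ N ⟶ M where
  app x := indDesc.{u, v, w, t} (fun d f => α.app d ≫ M.map f) fun φ f => by simp
  naturality x y φ := indModule_hom_ext.{u, v, w, t} fun d f => by
    rw [← Category.assoc, indInj_map, indInj_desc, ← Category.assoc, indInj_desc, M.map_comp,
      Category.assoc]

theorem indInj_indHom_app {M : C ⥤ ModuleCat.{max t u v} k} (α : N ⟶ τ ⋙ M) {d : D} {x : C}
    (f : τ.obj d ⟶ x) :
    indInj.{u, v, w, t} τ N f ≫ (indHom.{u, v, w, t} α).app x = α.app d ≫ M.map f :=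
  indInj_desc.{u, v, w, t} _ (fun φ f => by simp) f

/-- A colimit of zero modules is zero: otherwise the identity of the value at `x` would vanish on
every `indInj`. -/
theorem exists_mem_moduleSupport_of_mem_indModule {x : C}
    (hx : x ∈ moduleSupport (indModule.{u, v, w, t} τ N)) :
    ∃ d ∈ moduleSupport N, Nonempty (τ.obj d ⟶ x) := by
  by_contra! h
  have h0 : 𝟙 ((indModule.{u, v, w, t} τ N).obj x) = 0 :=
    indModule_hom_ext.{u, v, w, t} fun d f => by
      have : Subsingleton (N.obj d) := not_nontrivial_iff_subsingleton.1 fun hd =>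
        (h d hd).false f
      exact (ModuleCat.isZero_of_subsingleton _).eq_of_src _ _
  have := ModuleCat.isZero_iff_subsingleton.1 ((IsZero.iff_id_eq_zero _).2 h0)
  exact not_nontrivial_iff_subsingleton.2 this hx

end Induction

/-! ### Supports and the coideals they generate -/

section Support

variable {G : Type u} [Group G] {P : Type v} [PartialOrder P] [MulAction G P]
  [CovariantClass G P (· • ·) (· ≤ ·)] {k : Type w} [CommRing k]
  {S T : TransporterSub G P} {N : S.Cat ⥤ ModuleCat.{t} k}

theorem eq_of_notMem_moduleSupport {q : S.Cat} (hq : q ∉ moduleSupport N)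
    {A : ModuleCat.{t} k} (p p' : N.obj q ⟶ A) : p = p' :=
  have : Subsingleton (N.obj q) := not_nontrivial_iff_subsingleton.1 hq
  (ModuleCat.isZero_of_subsingleton _).eq_of_src _ _

/-- The element `h` is an isomorphism from `x` to `h • x` in `Q ⋊ H`, and `N` preserves it. -/
theorem supportPoset_smul_mem {h : G} (hh : h ∈ S.grp) {x : P} (hx : x ∈ supportPoset N) :
    h • x ∈ supportPoset N := by
  obtain ⟨q, hq, rfl⟩ := hx
  have e : q ≅ (⟨⟨h • (q.pt : P), S.smul_mem h hh _ q.pt.2⟩⟩ : S.Cat) :=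
    { hom := ⟨⟨h, hh⟩, le_rfl⟩
      inv := ⟨⟨h, hh⟩⁻¹, (inv_smul_smul h (q.pt : P)).le⟩
      hom_inv_id := Transporter.Hom.ext (inv_mul_cancel _)
      inv_hom_id := Transporter.Hom.ext (mul_inv_cancel _) }
  have : Nontrivial (N.obj q) := hq
  exact ⟨_, (N.mapIso e).toLinearEquiv.symm.toEquiv.nontrivial, rfl⟩

/-- The support is `H`-stable, so its plain coideal already absorbs the group part of `φ`. -/
theorem mem_coidealGen_supportPoset {q q' : S.Cat} (hq : q ∈ moduleSupport N) (φ : q ⟶ q') :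
    (q'.pt : P) ∈ coidealGen (⊥ : Subgroup G) (supportPoset N) :=
  ⟨1, one_mem _, _, supportPoset_smul_mem φ.elt.2 ⟨q, hq, rfl⟩, by
    rw [one_smul]
    exact φ.rel⟩

end Support

/-! ### Comparison maps from the summands -/

section Mackey

variable {G : Type u} [Group G] {P : Type v} [PartialOrder P] [MulAction G P]
  [CovariantClass G P (· • ·) (· ≤ ·)] {k : Type w} [CommRing k]
  (S T : TransporterSub G P) (N : S.Cat ⥤ ModuleCat.{max t u v} k)

/-- The functor `(R ∩ ᵍQ) ⋊ (K ∩ ᵍH) ⥤ Q ⋊ H` that sends `y` to `g⁻¹ • y`. -/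
def conjInfFunctor (g : G) : (T ⊓ S.conj g).Cat ⥤ S.Cat :=
  TransporterSub.inclOfLE
      (TransporterSub.le_of_eq' (TransporterSub.conj_inf_conj_inv g S T).symm) ⋙
    (T.conj g⁻¹ ⊓ S).unconj g ⋙
      TransporterSub.inclOfLE (TransporterSub.inf_le_right' (T.conj g⁻¹) S)

/-- The inclusion of `(R ∩ ᵍQ) ⋊ (K ∩ ᵍH)` in `R ⋊ K`. -/
abbrev infIncl (g : G) : (T ⊓ S.conj g).Cat ⥤ T.Cat :=
  TransporterSub.inclOfLE (TransporterSub.inf_le_left' T (S.conj g))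

/-- The canonical map from `N (g⁻¹ • y)` to the value at `x` of the summand at `g`. -/
noncomputable abbrev summandInj {g : G} {x : T.Cat} {y : (T ⊓ S.conj g).Cat}
    (κ : (infIncl S T g).obj y ⟶ x) :
    N.obj ((conjInfFunctor S T g).obj y) ⟶ (mackeySummand.{u, v, w, t} S T N g).obj x :=
  indInj.{u, v, w, t} (infIncl S T g) (conjInfFunctor S T g ⋙ N) κ

/-- The morphism `g : g⁻¹ • y ⟶ y`, natural in `y`. -/
def conjInfIncl (g : G) : conjInfFunctor S T g ⋙ S.incl ⟶ infIncl S T g ⋙ T.incl where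
  app y := ⟨g, (smul_inv_smul g (y.pt : P)).le⟩
  naturality y y' l := Transporter.Hom.ext (by
    change g * (g⁻¹ * (l.elt : G) * g) = (l.elt : G) * g
    group)

/-- The morphism from the summand at `g` to the restriction of the induced module. -/
noncomputable def mackeyLeg (g : G) :
    mackeySummand.{u, v, w, t} S T N g ⟶
      resModule.{u, v, w, t} T.incl (indModule.{u, v, w, t} S.incl N) :=
  -- The summand unfolds to the Kan extension of `conjInfFunctor S T g ⋙ N`; on `N (g⁻¹ • y)` the
  -- leg is the colimit map indexed by `g : g⁻¹ • y ⟶ y`.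
  indHom.{u, v, w, t} (τ := infIncl S T g) (N := conjInfFunctor S T g ⋙ N)
    { app := fun y => indInj.{u, v, w, t} S.incl N ((conjInfIncl S T g).app y)
      naturality := fun y y' l => by
        refine (map_indInj.{u, v, w, t} S.incl N ((conjInfFunctor S T g).map l) _).trans ?_
        refine Eq.trans ?_ (indInj_map.{u, v, w, t} S.incl N _ _).symm
        exact congrArg _ ((conjInfIncl S T g).naturality l) }

theorem summandInj_mackeyLeg {g : G} {x : T.Cat} {y : (T ⊓ S.conj g).Cat}
    (κ : (infIncl S T g).obj y ⟶ x) :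
    summandInj.{u, v, w, t} S T N κ ≫ (mackeyLeg.{u, v, w, t} S T N g).app x =
      indInj.{u, v, w, t} S.incl N ((conjInfIncl S T g).app y ≫ T.incl.map κ) :=
  (indInj_indHom_app.{u, v, w, t} _ κ).trans (indInj_map.{u, v, w, t} S.incl N _ _)

variable {S T N}

/-! ### Factorizations through double coset representatives -/

/-- A factorization `a = k g h` of a morphism `a` from an object `q` of `Q ⋊ H` to an object `x` of
`R ⋊ K`, where `h : q ⟶ g⁻¹ • y` is an isomorphism and `k : y ⟶ x`. -/
structure MackeyFactor (D : Set G) {q : S.Cat} {x : T.Cat} (a : S.incl.obj q ⟶ T.incl.obj x) where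
  /-- the representative of the double coset -/
  rep : D
  /-- the intermediate object -/
  mid : (T ⊓ S.conj (rep : G)).Cat
  /-- the component in `Q ⋊ H` -/
  left : q ⟶ (conjInfFunctor S T (rep : G)).obj mid
  /-- the component in `R ⋊ K` -/
  right : (infIncl S T (rep : G)).obj mid ⟶ x
  left_eq : (left.elt : G) • (q.pt : P) = (rep : G)⁻¹ • (mid.pt : P)
  elt_eq : a.elt = (right.elt : G) * rep * left.elt

namespace MackeyFactor

variable {D : Set G} {q q' : S.Cat} {x : T.Cat} {a : S.incl.obj q ⟶ T.incl.obj x}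
  {a' : S.incl.obj q' ⟶ T.incl.obj x}

theorem comp_eq (m : MackeyFactor D a) :
    S.incl.map m.left ≫ (conjInfIncl S T (m.rep : G)).app m.mid ≫ T.incl.map m.right = a :=
  Transporter.Hom.ext m.elt_eq.symm

theorem mem_doubleCoset (m : MackeyFactor D a) :
    a.elt ∈ DoubleCoset.doubleCoset (m.rep : G) (T.grp : Set G) (S.grp : Set G) :=
  DoubleCoset.mem_doubleCoset.2 ⟨_, m.right.elt.2, _, m.left.elt.2, m.elt_eq⟩

/-- The map to the summand that a factorization defines. -/
noncomputable def toSummand (N : S.Cat ⥤ ModuleCat.{max t u v} k) (m : MackeyFactor D a)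
    {A : ModuleCat.{max t u v} k}
    (s : ∀ g : D, (mackeySummand.{u, v, w, t} S T N (g : G)).obj x ⟶ A) : N.obj q ⟶ A :=
  N.map m.left ≫ summandInj.{u, v, w, t} S T N m.right ≫ s m.rep

/-- The two factorizations are linked by a morphism between their middle objects. With `φ = 𝟙` this
is independence of the factorization; in general it is the cocone condition. -/
theorem map_toSummand (hD : IsDoubleCosetReps T.grp S.grp D) (φ : q ⟶ q')
    (ha : S.incl.map φ ≫ a' = a) (m : MackeyFactor D a) (m' : MackeyFactor D a')
    {A : ModuleCat.{max t u v} k}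
    (s : ∀ g : D, (mackeySummand.{u, v, w, t} S T N (g : G)).obj x ⟶ A) :
    N.map φ ≫ m'.toSummand.{u, v, w, t} N s = m.toSummand.{u, v, w, t} N s := by
  have hae : a.elt = a'.elt * φ.elt := congrArg Transporter.Hom.elt ha.symm
  -- The elements of `a` and `a'` differ by one of `H`, so they lie in the same double coset.
  have hrep : m.rep = m'.rep := by
    refine Subtype.ext ((hD a.elt).unique ⟨m.rep.2, m.mem_doubleCoset⟩ ⟨m'.rep.2, ?_⟩)
    refine DoubleCoset.mem_doubleCoset.2
      ⟨_, m'.right.elt.2, _, (m'.left.elt * φ.elt).2, ?_⟩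
    rw [hae, m'.elt_eq, Subgroup.coe_mul, ← mul_assoc]
  obtain ⟨g, y, f, κ, hf, he⟩ := m
  obtain ⟨g', y', f', κ', hf', he'⟩ := m'
  obtain rfl : g = g' := hrep
  dsimp only [toSummand] at *
  have key : (κ.elt : G) * g * f.elt = (κ'.elt : G) * g * f'.elt * φ.elt := by
    rw [← he, hae, he']
  -- The left side is in `K`, the right side in `ᵍH`: this is the element of the linking morphism
  -- `l`.
  have hl : (κ'.elt : G)⁻¹ * κ.elt = g * ((f'.elt : G) * φ.elt * (f.elt : G)⁻¹) * (g : G)⁻¹ := by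
    rw [inv_mul_eq_iff_eq_mul, ← mul_left_inj (g : G), ← mul_left_inj (f.elt : G), key]
    group
  let l : y ⟶ y' := ⟨⟨(κ'.elt : G)⁻¹ * κ.elt,
    T.grp.mul_mem (T.grp.inv_mem κ'.elt.2) κ.elt.2,
    ⟨_, (f'.elt * φ.elt * f.elt⁻¹).2, hl.symm⟩⟩, by
      change ((κ'.elt : G)⁻¹ * κ.elt) • (y.pt : P) ≤ y'.pt
      -- Since `left_eq` is an equality, `f` can be undone on points, which reduces the relation to
      -- `φ.rel`.
      rw [hl, mul_smul, ← hf, ← mul_smul, mul_assoc, inv_mul_cancel_right, mul_smul, mul_smul,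
        ← smul_inv_smul (g : G) (y'.pt : P), ← hf']
      exact smul_mono_right (g : G) (smul_mono_right (f'.elt : G) φ.rel)⟩
  have h1 : (infIncl S T (g : G)).map l ≫ κ' = κ :=
    Transporter.Hom.ext (Subtype.ext (mul_inv_cancel_left (κ'.elt : G) κ.elt))
  have h2 : f ≫ (conjInfFunctor S T (g : G)).map l = φ ≫ f' := by
    refine Transporter.Hom.ext (Subtype.ext ?_)
    change ((g : G)⁻¹ * ((κ'.elt : G)⁻¹ * κ.elt) * g) * f.elt = (f'.elt : G) * φ.elt
    rw [hl]
    group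
  have h3 := map_indInj.{u, v, w, t} (infIncl S T (g : G)) (conjInfFunctor S T (g : G) ⋙ N) l κ'
  rw [h1] at h3
  rw [← N.map_comp_assoc, ← h2, N.map_comp_assoc]
  exact congrArg (N.map f ≫ ·) (congrArg (· ≫ s g) h3)

end MackeyFactor

theorem exists_mackeyFactor {N : S.Cat ⥤ ModuleCat.{t} k} (hM : MackeyCondition S T N) {D : Set G}
    (hD : IsDoubleCosetReps T.grp S.grp D) {q : S.Cat}
    (hq : (q.pt : P) ∈ coidealGen (⊥ : Subgroup G) (supportPoset N)) {x : T.Cat}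
    (a : S.incl.obj q ⟶ T.incl.obj x) : Nonempty (MackeyFactor D a) := by
  obtain ⟨g, ⟨hg, ha⟩, -⟩ := hD a.elt
  obtain ⟨κ, hκ, h, hh, he⟩ := DoubleCoset.mem_doubleCoset.1 ha
  -- `(∗)` is applied with `a.elt` itself as conjugating element, not with the representative.
  have haq : a.elt • (q.pt : P) ∈ T.carrier :=
    (hM a.elt _ x.pt.2 ⟨Set.smul_mem_smul_set hq, a.rel⟩).1
  have hy : g • h • (q.pt : P) ∈ T.carrier := by
    have := T.smul_mem κ⁻¹ (T.grp.inv_mem hκ) _ haq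
    rwa [he, mul_assoc, mul_smul, inv_smul_smul, mul_smul] at this
  exact ⟨{
    rep := ⟨g, hg⟩
    mid := ⟨⟨g • h • (q.pt : P), hy, Set.smul_mem_smul_set (S.smul_mem h hh _ q.pt.2)⟩⟩
    left := ⟨⟨h, hh⟩, (inv_smul_smul g (h • (q.pt : P))).ge⟩
    right := ⟨⟨κ, hκ⟩, by
      have := a.rel
      rw [he, mul_smul, mul_smul] at this
      exact this⟩
    left_eq := (inv_smul_smul g (h • (q.pt : P))).symm
    elt_eq := he }⟩

/-! ### The universal property of the direct sum -/

open Classical in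
/-- The family of maps, indexed by the objects of `Q ⋊ H` over `x`, that is induced by maps out of
the summands. -/
noncomputable def mackeyFamily (hM : MackeyCondition.{u, v, w, max t u v} S T N) {D : Set G}
    (hD : IsDoubleCosetReps T.grp S.grp D) {x : T.Cat} {A : ModuleCat.{max t u v} k}
    (s : ∀ g : D, (mackeySummand.{u, v, w, t} S T N (g : G)).obj x ⟶ A) (q : S.Cat)
    (a : S.incl.obj q ⟶ T.incl.obj x) : N.obj q ⟶ A :=
  -- Off the support a factorization need not exist, but `N q = 0` forces the value.
  if hq : q ∈ moduleSupport N then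
    (exists_mackeyFactor hM hD
      (mem_coidealGen_supportPoset hq (𝟙 q)) a).some.toSummand.{u, v, w, t} N s
  else 0

theorem mackeyFamily_eq (hM : MackeyCondition.{u, v, w, max t u v} S T N) {D : Set G}
    (hD : IsDoubleCosetReps T.grp S.grp D) {x : T.Cat} {A : ModuleCat.{max t u v} k}
    (s : ∀ g : D, (mackeySummand.{u, v, w, t} S T N (g : G)).obj x ⟶ A) {q : S.Cat}
    {a : S.incl.obj q ⟶ T.incl.obj x} (m : MackeyFactor D a) :
    mackeyFamily.{u, v, w, t} hM hD s q a = m.toSummand.{u, v, w, t} N s := by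
  by_cases hq : q ∈ moduleSupport N
  · rw [mackeyFamily, dif_pos hq, ← MackeyFactor.map_toSummand.{u, v, w, t} hD (𝟙 q)
      (by simp) m (exists_mackeyFactor hM hD (mem_coidealGen_supportPoset hq (𝟙 q)) a).some s,
      N.map_id, Category.id_comp]
  · exact eq_of_notMem_moduleSupport hq _ _

/-- Even if `q` is in the support, `q'` may not be; it is still in the coideal generated by the
support, so a factorization exists there too. This is why `(∗)` speaks of the coideal. -/
theorem map_mackeyFamily (hM : MackeyCondition.{u, v, w, max t u v} S T N) {D : Set G}
    (hD : IsDoubleCosetReps T.grp S.grp D) {x : T.Cat} {A : ModuleCat.{max t u v} k}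
    (s : ∀ g : D, (mackeySummand.{u, v, w, t} S T N (g : G)).obj x ⟶ A) {q q' : S.Cat}
    (φ : q ⟶ q') (a : S.incl.obj q' ⟶ T.incl.obj x) :
    N.map φ ≫ mackeyFamily.{u, v, w, t} hM hD s q' a =
      mackeyFamily.{u, v, w, t} hM hD s q (S.incl.map φ ≫ a) := by
  by_cases hq : q ∈ moduleSupport N
  · obtain ⟨m⟩ := exists_mackeyFactor hM hD (mem_coidealGen_supportPoset hq (𝟙 q))
      (S.incl.map φ ≫ a)
    obtain ⟨m'⟩ := exists_mackeyFactor hM hD (mem_coidealGen_supportPoset hq φ) a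
    rw [mackeyFamily_eq.{u, v, w, t} hM hD s m, mackeyFamily_eq.{u, v, w, t} hM hD s m',
      MackeyFactor.map_toSummand.{u, v, w, t} hD φ rfl m m' s]
  · exact eq_of_notMem_moduleSupport hq _ _

/-- The factorization of the morphism `k g : g⁻¹ • y ⟶ x`. -/
def MackeyFactor.ofMid {D : Set G} (g : D) {x : T.Cat} {y : (T ⊓ S.conj (g : G)).Cat}
    (κ : (infIncl S T (g : G)).obj y ⟶ x) :
    MackeyFactor D ((conjInfIncl S T (g : G)).app y ≫ T.incl.map κ) where
  rep := g
  mid := y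
  left := 𝟙 _
  right := κ
  left_eq := one_smul G ((g : G)⁻¹ • (y.pt : P))
  elt_eq := (mul_one _).symm

/-- If `(∗)` holds, the restriction of the induced module is, at each object, the direct sum of the
values of the summands. -/
noncomputable def isColimitMackeyCofanApp (hM : MackeyCondition.{u, v, w, max t u v} S T N)
    {D : Set G} (hD : IsDoubleCosetReps T.grp S.grp D) (x : T.Cat) :
    IsColimit (Cofan.mk _ fun g : D => (mackeyLeg.{u, v, w, t} S T N (g : G)).app x :
      Cofan fun g : D => (mackeySummand.{u, v, w, t} S T N (g : G)).obj x) :=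
  Cofan.IsColimit.mk _
    (fun s => indDesc.{u, v, w, t} (mackeyFamily.{u, v, w, t} hM hD s.inj)
      (map_mackeyFamily.{u, v, w, t} hM hD s.inj))
    (fun s g => indModule_hom_ext.{u, v, w, t} fun y κ => by
      refine (Category.assoc _ _ _).symm.trans
        ((congrArg (· ≫ _) (summandInj_mackeyLeg.{u, v, w, t} S T N κ)).trans ?_)
      refine (indInj_desc.{u, v, w, t} _ (map_mackeyFamily.{u, v, w, t} hM hD s.inj) _).trans ?_
      refine (mackeyFamily_eq.{u, v, w, t} hM hD s.inj (MackeyFactor.ofMid g κ)).trans ?_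
      exact (congrArg (· ≫ _) (N.map_id _)).trans (Category.id_comp _))
    (fun s m hm => indModule_hom_ext.{u, v, w, t} fun q a => by
      rw [indInj_desc]
      by_cases hq : q ∈ moduleSupport N
      -- The factorization carries the colimit map at `a` through a leg, where `m` is prescribed.
      · obtain ⟨f⟩ := exists_mackeyFactor hM hD (mem_coidealGen_supportPoset hq (𝟙 q)) a
        rw [mackeyFamily_eq.{u, v, w, t} hM hD s.inj f, MackeyFactor.toSummand, ← hm f.rep]
        have h := summandInj_mackeyLeg.{u, v, w, t} S T N f.right
        have h' := map_indInj.{u, v, w, t} S.incl N f.left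
          ((conjInfIncl S T (f.rep : G)).app f.mid ≫ T.incl.map f.right)
        rw [f.comp_eq, ← h] at h'
        exact (congrArg (· ≫ m) h'.symm).trans
          ((Category.assoc _ _ _).trans (congrArg _ (Category.assoc _ _ _)))
      · exact eq_of_notMem_moduleSupport hq _ _)

/-- If `(∗)` holds, the restriction of the induced module is the direct sum of the summands. -/
noncomputable def isColimitMackeyCofan (hM : MackeyCondition.{u, v, w, max t u v} S T N)
    {D : Set G} (hD : IsDoubleCosetReps T.grp S.grp D) :
    IsColimit (Cofan.mk _ fun g : D => mackeyLeg.{u, v, w, t} S T N (g : G) :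
      Cofan fun g : D => mackeySummand.{u, v, w, t} S T N (g : G)) :=
  evaluationJointlyReflectsColimits _ fun x =>
    (isColimitMapCoconeCofanMkEquiv ((evaluation _ _).obj x) _ _).symm
      (isColimitMackeyCofanApp.{u, v, w, t} hM hD x)

/-! ### Ideals and convex support -/

theorem mackeyCondition_of_isLowerSet (hT : IsLowerSet T.carrier) :
    MackeyCondition.{u, v, w, max t u v} S T N :=
  fun _ _ hx _ hy => ⟨hT hy.2 hx, hy.2⟩

theorem isIdealIn_inter_coidealGen (hM : MackeyCondition.{u, v, w, max t u v} S T N) :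
    IsIdealIn (T.carrier ∩ coidealGen (⊤ : Subgroup G) (convexSupportPoset N))
      (coidealGen (⊤ : Subgroup G) (convexSupportPoset N)) := by
  refine ⟨Set.inter_subset_right, fun x hx y hy hyx => ⟨?_, hy⟩⟩
  obtain ⟨g, -, _, ⟨q, ⟨q₀, hq₀, _, -, ⟨φ⟩, -⟩, rfl⟩, hg⟩ := hy
  -- A point of the convex support lies above the support, so `g⁻¹ • y` is in the coideal generated
  -- by `Q_N`.
  refine (hM g x hx.1 ⟨Set.mem_smul_set_iff_inv_smul_mem.2 ?_, hyx⟩).1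
  obtain ⟨h, hh, z, hz, hzq⟩ := mem_coidealGen_supportPoset hq₀ φ
  refine ⟨h, hh, z, hz, hzq.trans ?_⟩
  simpa using smul_mono_right g⁻¹ hg

/-- Only the lower half of convexity matters, because the target is up-closed. -/
theorem moduleConvexSupport_indModule_subset :
    Transporter.pt '' moduleConvexSupport (indModule.{u, v, w, t} S.incl N) ⊆
      coidealGen (⊤ : Subgroup G) (convexSupportPoset N) := by
  rintro _ ⟨y, ⟨x, hx, _, -, ⟨φ⟩, -⟩, rfl⟩
  obtain ⟨q, hq, ⟨a⟩⟩ := exists_mem_moduleSupport_of_mem_indModule.{u, v, w, t} hx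
  exact ⟨_, Subgroup.mem_top _, _,
    ⟨q, ⟨q, hq, q, hq, ⟨𝟙 q⟩, ⟨𝟙 q⟩⟩, rfl⟩, (a ≫ φ).rel⟩

end Mackey

theorem theorem4p18 {G : Type u} [Group G] {P : Type v} [PartialOrder P] [MulAction G P]
    [CovariantClass G P (· • ·) (· ≤ ·)] {k : Type w} [CommRing k]
    (S T : TransporterSub G P) (N : S.Cat ⥤ ModuleCat.{max t u v} k) :
    (IsLowerSet T.carrier → MackeyCondition S T N) ∧
    (MackeyCondition S T N →
      IsIdealIn (T.carrier ∩ coidealGen (⊤ : Subgroup G) (convexSupportPoset N))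
        (coidealGen (⊤ : Subgroup G) (convexSupportPoset N)) ∧
      Transporter.pt '' moduleConvexSupport (indModule.{u, v, w, t} S.incl N) ⊆
        coidealGen (⊤ : Subgroup G) (convexSupportPoset N) ∧
      ∀ D : Set G, IsDoubleCosetReps T.grp S.grp D →
        Nonempty (resModule.{u, v, w, t} T.incl (indModule.{u, v, w, t} S.incl N) ≅
          ∐ fun g : D => mackeySummand.{u, v, w, t} S T N (g : G))) :=
  ⟨mackeyCondition_of_isLowerSet.{u, v, w, t}, fun hM =>
    ⟨isIdealIn_inter_coidealGen.{u, v, w, t} hM, moduleConvexSupport_indModule_subset.{u, v, w, t},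
      fun _ hD => ⟨(isColimitMackeyCofan.{u, v, w, t} hM hD).coconePointUniqueUpToIso
        (coproductIsCoproduct _)⟩⟩⟩
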